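/- Let $\mathcal I=\{\emptyset\}\cup\bigcup_{n\ge1}\{1,2\}^n$ be the full binary tree; for $v\in\mathcal I$ write $|v|$ for its length and $v|j$ for its initial segment of length $j\le|v|$. Let $(T_v)_{v\in\mathcal I}$ be i.i.d. exponential random variables with mean one on a probability space, and let $\alpha\in(1,2)$. Define the set of $t$-leaves by $V(0)=\{\emptyset\}$ and $$V(t)=\Big\{v\in\mathcal I:\ \sum_{j=0}^{|v|-1}\alpha^{-j}T_{v|j}\le t<\sum_{j=0}^{|v|}\alpha^{-j}T_{v|j}\Big\},\qquad t>0,$$ let $G_t=\{V(t)\text{ is finite (possibly empty)}\}$, and let the shortest path be $$S=\lim_{n\to\infty}\min_{|v|=n}\sum_{j=0}^{n}\alpha^{-j}T_{v|j}\in[0,\infty].$$ Consider the $\alpha$-Riccati equation $u'(t)=-u(t)+u(\alpha t)^2$, $t\ge0$ (with the right derivative at $t=0$), with initial condition $u(0)=u_0$. For $u_0=1$, each of the three functions $v(t)=\mathbb P(G_t)$, $\underline u(t)=\mathbb P(S>t)$ and $\overline u(t)\equiv1$ is a solution on $[0,\infty)$, and $$\underline u(t)<v(t)<\overline u(t)\qquad\text{for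 all }t>0.$$ In particular $v$ is distinct from both $\underline u$ and $\overline u$, so solutions with $u_0=1$ are not unique. -/

import Mathlib

open MeasureTheory ProbabilityTheory Filter

namespace AlphaRiccati

/-- Vertices of the full binary tree `{∅} ∪ ⋃ₙ {1,2}ⁿ`: finite words in two letters.
The root is `[]`, the generation `|v|` is `v.length`, and the ancestor `v|j` is `v.take j`. -/
abbrev Vertex : Type := List (Fin 2)

/-- `∑_{j < m} α^{-j} T_{v|j}`, for a realization `T` of the clocks. -/
noncomputable def partialSum (α : ℝ) (T : Vertex → ℝ) (v : Vertex) (m : ℕ) : ℝ :=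
  ∑ j ∈ Finset.range m, (α⁻¹) ^ j * T (v.take j)

open scoped Classical in
/-- The set `V(t)` of `t`-leaves, with the convention `V(0) = {∅}`. -/
noncomputable def leaves (α : ℝ) (T : Vertex → ℝ) (t : ℝ) : Set Vertex :=
  if t = 0 then {[]}
  else {v | partialSum α T v v.length ≤ t ∧ t < partialSum α T v (v.length + 1)}

/-- The shortest path `S = lim_{n → ∞} min_{|v| = n} ∑_{j=0}^{n} α^{-j} T_{v|j}`, an extended real.
When the clocks are nonnegative the minima increase with `n`, so that the `liminf` is a limit. -/
noncomputable def shortestPath (α : ℝ) (T : Vertex → ℝ) : EReal :=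
  liminf (fun n : ℕ => ⨅ (v : Vertex) (_ : v.length = n), (partialSum α T v (n + 1) : EReal)) atTop

/-- `u` solves the `α`-Riccati equation `u'(t) = -u(t) + u(αt)²` for `t ≥ 0` (with the one-sided
derivative at `t = 0`), with initial data `u(0) = u₀`. Only the values of `u` on `[0, ∞)` matter. -/
structure IsSolution (α u₀ : ℝ) (u : ℝ → ℝ) : Prop where
  initial : u 0 = u₀
  hasDeriv : ∀ t : ℝ, 0 ≤ t → HasDerivWithinAt u (-u t + u (α * t) ^ 2) (Set.Ici 0) t

/-- `T` is a family of i.i.d. mean-one exponential random variables indexed by the tree. -/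
structure IsExpClocks {Ω : Type*} [MeasurableSpace Ω] (P : Measure Ω)
    (T : Vertex → Ω → ℝ) : Prop where
  measurable : ∀ v, Measurable (T v)
  law : ∀ v, P.map (T v) = expMeasure 1
  indep : iIndepFun T P

/-- The event `G_t` that zero or finitely many branches of the cascade cross `t`. -/
def finiteCrossing {Ω : Type*} (α : ℝ) (T : Vertex → Ω → ℝ) (t : ℝ) : Set Ω :=
  {ω | (leaves α (fun v => T v ω) t).Finite}

/-- The event `S > t`. -/
def shortestPathGT {Ω : Type*} (α : ℝ) (T : Vertex → Ω → ℝ) (t : ℝ) : Set Ω :=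
  {ω | (t : EReal) < shortestPath α (fun v => T v ω)}

end AlphaRiccati

namespace AlphaRiccati

open Set Topology

/-! ### The recursive structure of the tree -/

/-! Condition on the root clock: a bounded functional that equals `a` before the first branching and
then factors over the two subtrees at the rescaled time has an expectation solving the Riccati
equation from `a` (`IsRenewal.isSolution`). This covers the indicator of `S > t` and, for `a ∈ [0,
1]`, `a ^ |V(t)|` on finite `V(t)`, with expectation `u_a`; then `u_1 = v`, and `u_0` is the
probability that `V(t)` is empty.

Lower gap: `S > t` forces `V(t)` to be finite and nonempty, so `P(S > t) + u_0 ≤ v`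
(`expect_shortInd_add_le`). Path lengths are almost surely bounded, hence `u_0 → 1`, and
`pos_of_exists_pos` spreads positivity of `u_0` to all `t > 0`.

Upper gap: for `a < 1`, `u_a → 1` by comparison with `u_0`, yet `IsSolution.exists_lt` forces `u_a`
below `α - 1` somewhere. Since `u_0` exceeds `α - 1` at large times, the dips stay in one compact
interval, and as `a ↑ 1` compactness yields a time with `v ≤ α - 1 < 1`. Positivity applied to `1 -
v` gives `v < 1` on `(0, ∞)`. -/

/-- The tree with root label `r` and subtrees `y 0` and `y 1`. -/
def join (p : ℝ × (Fin 2 → Vertex → ℝ)) : Vertex → ℝ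
  | [] => p.1
  | i :: w => p.2 i w

@[simp] lemma join_nil (p : ℝ × (Fin 2 → Vertex → ℝ)) : join p [] = p.1 := rfl

@[simp] lemma join_cons (p : ℝ × (Fin 2 → Vertex → ℝ)) (i : Fin 2) (w : Vertex) :
    join p (i :: w) = p.2 i w := rfl

lemma measurable_join : Measurable join := by
  rw [measurable_pi_iff]
  rintro (_ | ⟨i, w⟩)
  · exact measurable_fst
  · exact (measurable_pi_apply w).comp ((measurable_pi_apply i).comp measurable_snd)

instance isProbabilityMeasure_expMeasure_one : IsProbabilityMeasure (expMeasure 1) :=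
  isProbabilityMeasure_expMeasure one_pos

/-- The law of a tree of independent mean-one exponential clocks. -/
noncomputable def clockLaw : Measure (Vertex → ℝ) := Measure.infinitePi fun _ => expMeasure 1

instance : IsProbabilityMeasure clockLaw := by unfold clockLaw; infer_instance

open scoped Classical in
/-- A tree of clocks is an exponential root clock together with two independent trees. -/
lemma map_join :
    ((expMeasure 1).prod (Measure.pi fun _ : Fin 2 => clockLaw)).map join = clockLaw := by
  refine Measure.eq_infinitePi _ fun s t ht => ?_
  -- Factors outside `s` become `univ`, of mass one, so the root can be adjoined even when it is not
  -- in `s`.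
  let t' : Vertex → Set ℝ := fun v => if v ∈ s then t v else univ
  have ht' : ∀ v, MeasurableSet (t' v) := fun v => by
    by_cases h : v ∈ s <;> simp [t', h, ht]
  let S : Fin 2 → Finset Vertex := fun i => s.preimage (List.cons i) (List.cons_injective.injOn)
  have hpre : join ⁻¹' (Set.pi s t) =
      t' [] ×ˢ Set.pi univ (fun i => Set.pi (S i) (fun w => t' (i :: w))) := by
    ext p
    simp only [mem_preimage, Set.mem_pi, Finset.mem_coe, mem_prod, mem_univ, true_implies, S,
      Finset.mem_preimage]
    constructor
    · intro h
      refine ⟨?_, fun i w hw => ?_⟩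
      · by_cases h0 : ([] : Vertex) ∈ s
        · simpa [t', h0] using h _ h0
        · simp [t', h0]
      · simpa [t', hw] using h _ hw
    · rintro ⟨h0, h1⟩ (_ | ⟨i, w⟩) hv
      · simpa [t', hv] using h0
      · simpa [t', hv] using h1 i w hv
  rw [Measure.map_apply measurable_join
    (MeasurableSet.pi s.countable_toSet fun v _ => ht v), hpre, Measure.prod_prod,
    Measure.pi_pi]
  have h1 : ∀ i, clockLaw (Set.pi (S i) (fun w => t' (i :: w))) =
      ∏ w ∈ S i, expMeasure 1 (t' (i :: w)) := fun i =>
    Measure.infinitePi_pi _ (fun w _ => ht' _)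
  simp only [h1]
  have h2 : ∏ v ∈ s, expMeasure 1 (t v) = ∏ v ∈ s, expMeasure 1 (t' v) :=
    Finset.prod_congr rfl fun v hv => by simp [t', hv]
  have h3 : ∏ v ∈ s, expMeasure 1 (t' v) =
      ∏ v ∈ insert [] (Finset.univ.biUnion fun i => (S i).image (List.cons i)),
        expMeasure 1 (t' v) := by
    refine Finset.prod_subset ?_ fun v _ hv => by simp [t', hv]
    rintro (_ | ⟨i, w⟩) hv
    · simp
    · simp [S, hv]
  rw [h2, h3, Finset.prod_insert (by simp), Finset.prod_biUnion]
  · congr 1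
    refine Finset.prod_congr rfl fun i _ => ?_
    rw [Finset.prod_image (List.cons_injective.injOn)]
  · intro i _ j _ hij
    rw [Function.onFun, Finset.disjoint_left]
    rintro v hv hv'
    simp only [Finset.mem_image] at hv hv'
    obtain ⟨w, _, rfl⟩ := hv
    obtain ⟨w', _, h⟩ := hv'
    exact hij (List.cons.inj h).1.symm

lemma map_clocks {Ω : Type*} [MeasurableSpace Ω] {P : Measure Ω} [IsProbabilityMeasure P]
    {T : Vertex → Ω → ℝ} (hT : IsExpClocks P T) : P.map (fun ω v => T v ω) = clockLaw := by
  rw [(iIndepFun_iff_map_fun_eq_infinitePi_map hT.measurable).1 hT.indep]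
  simp only [hT.law]
  rfl

lemma map_eval_clockLaw (v : Vertex) : clockLaw.map (fun x => x v) = expMeasure 1 :=
  Measure.infinitePi_map_eval _ v

/-! ### The exponential law and almost sure positivity of the clocks. -/

lemma expMeasure_eq_withDensity :
    expMeasure 1 = volume.withDensity (exponentialPDF 1) := rfl

lemma expMeasure_Ioi {s : ℝ} (hs : 0 ≤ s) :
    expMeasure 1 (Ioi s) = ENNReal.ofReal (Real.exp (-s)) := by
  have h := cdf_expMeasure_eq one_pos s
  rw [cdf_eq_real, if_pos hs] at h
  have h2 := prob_compl_eq_one_sub (μ := expMeasure 1) (measurableSet_Iic (a := s))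
  rw [compl_Iic] at h2
  rw [h2, ← ofReal_measureReal, h, ← ENNReal.ofReal_one, ← ENNReal.ofReal_sub]
  · congr 1; simp
  · simp [hs]

lemma ae_clock_pos : ∀ᵐ x ∂clockLaw, ∀ v, 0 < x v := by
  rw [ae_all_iff]
  intro v
  have h : ∀ᵐ r ∂(expMeasure 1), 0 < r := by
    have := expMeasure_Ioi le_rfl
    simp only [neg_zero, Real.exp_zero, ENNReal.ofReal_one] at this
    exact (mem_ae_iff_prob_eq_one measurableSet_Ioi).2 this
  rw [← map_eval_clockLaw v] at h
  exact ae_of_ae_map (measurable_pi_apply v).aemeasurable h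

lemma integral_expMeasure (g : ℝ → ℝ) :
    ∫ r, g r ∂(expMeasure 1) = ∫ r in Ioi 0, Real.exp (-r) * g r := by
  rw [expMeasure_eq_withDensity, integral_withDensity_eq_integral_toReal_smul
    (by unfold exponentialPDF; fun_prop) (by simp [exponentialPDF]),
    ← integral_indicator measurableSet_Ioi]
  refine integral_congr_ae ?_
  have : ∀ᵐ r : ℝ, r ≠ 0 := by simp [ae_iff]
  filter_upwards [this] with r hr
  rcases lt_or_gt_of_ne hr with h | h
  · rw [exponentialPDF_of_neg h, indicator_of_notMem (by simpa using h.le)]; simp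
  · rw [exponentialPDF_of_nonneg h.le, indicator_of_mem (by simpa using h),
      ENNReal.toReal_ofReal (by positivity)]
    simp

lemma integral_clockLaw_eq {F : (Vertex → ℝ) → ℝ} (hF : Measurable F)
    (hb : ∀ x, ‖F x‖ ≤ 1) :
    ∫ x, F x ∂clockLaw =
      ∫ r, ∫ y, F (join (r, y)) ∂(Measure.pi fun _ : Fin 2 => clockLaw) ∂(expMeasure 1) := by
  conv_lhs => rw [← map_join]
  rw [integral_map measurable_join.aemeasurable hF.aestronglyMeasurable, integral_prod]
  exact Integrable.of_bound (hF.comp measurable_join).aestronglyMeasurable 1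
    (ae_of_all _ fun p => hb _)

/-! ### Renewal functionals -/

/-- The expectation of a functional of time and clocks under the law of the clocks. -/
noncomputable def expect (f : ℝ → (Vertex → ℝ) → ℝ) (t : ℝ) : ℝ :=
  ∫ x, f t x ∂clockLaw

/-- A bounded functional `f t x` of time and clocks which regenerates at the first branching. -/
structure IsRenewal (α a : ℝ) (f : ℝ → (Vertex → ℝ) → ℝ) : Prop where
  measurable : Measurable (Function.uncurry f)
  nonneg : ∀ t x, 0 ≤ f t x
  le_one : ∀ t x, f t x ≤ 1
  of_lt : ∀ t x, (∀ v, 0 < x v) → 0 ≤ t → t < x [] → f t x = a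
  of_le : ∀ t x, (∀ v, 0 < x v) → 0 ≤ t → x [] ≤ t →
    f t x = ∏ i : Fin 2, f (α * (t - x [])) (fun w => x (i :: w))

namespace IsRenewal

variable {α a : ℝ} {f : ℝ → (Vertex → ℝ) → ℝ}

lemma norm_le (hf : IsRenewal α a f) (t : ℝ) (x : Vertex → ℝ) : ‖f t x‖ ≤ 1 := by
  rw [Real.norm_of_nonneg (hf.nonneg t x)]; exact hf.le_one t x

lemma measurable_apply (hf : IsRenewal α a f) (t : ℝ) : Measurable (f t) :=
  hf.measurable.comp measurable_prodMk_left

lemma integrable (hf : IsRenewal α a f) (t : ℝ) : Integrable (f t) clockLaw :=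
  Integrable.of_bound (hf.measurable_apply t).aestronglyMeasurable 1 (ae_of_all _ (hf.norm_le t))

lemma expect_nonneg (hf : IsRenewal α a f) (t : ℝ) : 0 ≤ expect f t :=
  integral_nonneg (hf.nonneg t)

lemma expect_le_one (hf : IsRenewal α a f) (t : ℝ) : expect f t ≤ 1 := by
  have := integral_mono (hf.integrable t) (integrable_const 1) (hf.le_one t)
  simpa [expect] using this

lemma measurable_expect (hf : IsRenewal α a f) : Measurable (expect f) :=
  (hf.measurable.stronglyMeasurable.integral_prod_right (ν := clockLaw)).measurable

/-- The square comes from the independence of the two subtrees given the root clock `r`. -/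
lemma expect_eq_integral (hf : IsRenewal α a f) {t : ℝ} (ht : 0 ≤ t) :
    expect f t = ∫ r, (if t < r then a else expect f (α * (t - r)) ^ 2) ∂(expMeasure 1) := by
  rw [expect, integral_clockLaw_eq (hf.measurable_apply t) (hf.norm_le t)]
  have hpos : ∀ᵐ p ∂((expMeasure 1).prod (Measure.pi fun _ : Fin 2 => clockLaw)),
      ∀ v, 0 < join p v := by
    have := ae_clock_pos
    rw [← map_join] at this
    exact ae_of_ae_map measurable_join.aemeasurable this
  refine integral_congr_ae ?_
  filter_upwards [Measure.ae_ae_of_ae_prod hpos] with r hr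
  split_ifs with h
  · rw [integral_congr_ae (g := fun _ => a)]
    · simp
    · filter_upwards [hr] with y hy
      exact hf.of_lt _ _ hy ht h
  · rw [integral_congr_ae (g := fun y => ∏ i : Fin 2, f (α * (t - r)) (y i))]
    · rw [integral_fintype_prod_eq_prod (fun (_ : Fin 2) => f (α * (t - r)))]
      simp [expect, sq]
    · filter_upwards [hr] with y hy
      exact hf.of_le _ _ hy ht (not_lt.1 h)

/-- This is the variation of constants form, obtained by the substitution `r ↦ t - r`. -/
lemma expect_eq_intervalIntegral (hf : IsRenewal α a f) {t : ℝ} (ht : 0 ≤ t) :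
    expect f t = Real.exp (-t) * (a + ∫ r in (0 : ℝ)..t, Real.exp r * expect f (α * r) ^ 2) := by
  have hm := hf.measurable_expect
  have hE : IntegrableOn (fun r : ℝ => Real.exp (-r)) (Ioi 0) := by
    simpa using integrableOn_exp_mul_Ioi (a := -1) (by norm_num) 0
  have hI : IntegrableOn (fun r => Real.exp (-r) *
      (if t < r then a else expect f (α * (t - r)) ^ 2)) (Ioi 0) := by
    refine hE.mul_bdd (c := max |a| 1) ?_ ?_
    · exact (Measurable.ite measurableSet_Ioi measurable_const (by fun_prop)).aestronglyMeasurable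
    · refine ae_of_all _ fun r => ?_
      split_ifs with h
      · exact le_max_left _ _
      · refine le_max_of_le_right ?_
        rw [Real.norm_of_nonneg (sq_nonneg _)]
        exact pow_le_one₀ (hf.expect_nonneg _) (hf.expect_le_one _)
  rw [hf.expect_eq_integral ht, integral_expMeasure, ← Ioc_union_Ioi_eq_Ioi ht,
    setIntegral_union Ioc_disjoint_Ioi_same measurableSet_Ioi
      (hI.mono_set Ioc_subset_Ioi_self) (hI.mono_set (Ioi_subset_Ioi ht)),
    setIntegral_congr_fun (g := fun r => Real.exp (-r) * expect f (α * (t - r)) ^ 2)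
      measurableSet_Ioc (fun r hr => by simp [not_lt.2 hr.2]),
    setIntegral_congr_fun (s := Ioi t) (g := fun r => Real.exp (-r) * a)
      measurableSet_Ioi (fun r hr => by simp [mem_Ioi.1 hr]),
    integral_mul_const, integral_exp_neg_Ioi, ← intervalIntegral.integral_of_le ht, mul_add, add_comm]
  congr 1
  have := intervalIntegral.integral_comp_sub_left (a := 0) (b := t)
    (fun r => Real.exp (-(t - r)) * expect f (α * r) ^ 2) t
  simp only [sub_sub_cancel, sub_self, sub_zero] at this
  rw [this, ← intervalIntegral.integral_const_mul]
  refine intervalIntegral.integral_congr fun r _ => ?_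
  simp only [neg_sub, Real.exp_sub, Real.exp_neg]
  field_simp

/-- The expectation of a renewal functional solves the `α`-Riccati equation. -/
theorem isSolution (hf : IsRenewal α a f) (hα : 0 ≤ α) : IsSolution α a (expect f) := by
  have hm := hf.measurable_expect
  have hint : ∀ s t : ℝ, IntervalIntegrable (fun r => Real.exp r * expect f (α * r) ^ 2) volume s t := by
    intro s t
    have hb : ∀ r, ‖expect f (α * r) ^ 2‖ ≤ 1 := fun r => by
      rw [Real.norm_of_nonneg (sq_nonneg _)]
      exact pow_le_one₀ (hf.expect_nonneg _) (hf.expect_le_one _)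
    have hE := Real.continuous_exp.intervalIntegrable (μ := volume) s t
    exact ⟨hE.1.mul_bdd (c := 1) (Measurable.aestronglyMeasurable (by fun_prop)) (ae_of_all _ hb),
      hE.2.mul_bdd (c := 1) (Measurable.aestronglyMeasurable (by fun_prop)) (ae_of_all _ hb)⟩
  -- Bootstrap: a primitive of a merely bounded measurable integrand is continuous, which in turn
  -- makes the integrand continuous.
  have hcont : ContinuousOn (expect f) (Ici 0) := by
    have : Continuous fun t : ℝ => Real.exp (-t) *
        (a + ∫ r in (0 : ℝ)..t, Real.exp r * expect f (α * r) ^ 2) := by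
      have := intervalIntegral.continuous_primitive hint 0
      fun_prop
    exact this.continuousOn.congr fun t ht => hf.expect_eq_intervalIntegral ht
  -- Freezing the integrand on negative times makes it continuous on all of `ℝ`, so the two-sided
  -- fundamental theorem applies even at `t = 0`.
  have hφ : Continuous fun r : ℝ => Real.exp (max r 0) * expect f (α * max r 0) ^ 2 := by
    have : Continuous fun r : ℝ => expect f (α * max r 0) :=
      hcont.comp_continuous (by fun_prop) fun r => mem_Ici.2 (by positivity)
    fun_prop
  have heq : ∀ t ∈ Ici (0 : ℝ), expect f t = Real.exp (-t) *
      (a + ∫ r in (0 : ℝ)..t, Real.exp (max r 0) * expect f (α * max r 0) ^ 2) := by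
    intro t ht
    rw [hf.expect_eq_intervalIntegral ht]
    congr 2
    refine intervalIntegral.integral_congr fun r hr => ?_
    rw [uIcc_of_le ht] at hr
    simp [max_eq_left hr.1]
  refine ⟨by simpa using hf.expect_eq_intervalIntegral le_rfl, fun t ht => ?_⟩
  have hd := (((hasDerivAt_neg t).exp).mul ((intervalIntegral.integral_hasDerivAt_right
    (hφ.intervalIntegrable 0 t) (hφ.stronglyMeasurableAtFilter _ _) hφ.continuousAt).const_add a))
  refine (hd.hasDerivWithinAt.congr heq (heq t ht)).congr_deriv ?_
  rw [heq t ht, max_eq_left ht]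
  have := Real.exp_pos t
  simp only [Real.exp_neg]
  field_simp

end IsRenewal

/-! ### Qualitative properties of solutions -/

lemma IsSolution.continuousOn {α a : ℝ} {u : ℝ → ℝ} (hu : IsSolution α a u) :
    ContinuousOn u (Ici 0) :=
  fun t ht => (hu.hasDeriv t ht).continuousWithinAt

lemma monotoneOn_Ici_of_hasDerivWithinAt_nonneg {f f' : ℝ → ℝ}
    (hf : ∀ t, 0 ≤ t → HasDerivWithinAt f (f' t) (Ici 0) t) (hf' : ∀ t, 0 ≤ t → 0 ≤ f' t) :
    MonotoneOn f (Ici 0) := by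
  refine monotoneOn_of_hasDerivWithinAt_nonneg (f' := f') (convex_Ici 0)
    (fun t ht => (hf t ht).continuousWithinAt) (fun t ht => ?_) fun t ht => ?_
  · exact (hf t (interior_subset ht)).mono interior_subset
  · exact hf' t (interior_subset ht)

/-- A nonnegative solution of `f' = -f + G`, where `G(t)` is positive as soon as `f(αt)` is,
is either identically zero or positive on `(0, ∞)`. -/
lemma pos_of_exists_pos {α : ℝ} (hα : 1 < α) {f G : ℝ → ℝ} (hf : ∀ t, 0 ≤ f t)
    (hG : ∀ t, 0 ≤ G t) (hG' : ∀ t, 0 < f (α * t) → 0 < G t)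
    (hd : ∀ t, 0 ≤ t → HasDerivWithinAt f (-f t + G t) (Ici 0) t)
    {s : ℝ} (hs : 0 ≤ s) (hfs : 0 < f s) {t : ℝ} (ht : 0 < t) : 0 < f t := by
  have hmono : MonotoneOn (fun t => Real.exp t * f t) (Ici 0) := by
    refine monotoneOn_Ici_of_hasDerivWithinAt_nonneg (f' := fun t => Real.exp t * G t)
      (fun t ht => ?_) fun t _ => mul_nonneg (Real.exp_pos t).le (hG t)
    exact ((Real.hasDerivAt_exp t).hasDerivWithinAt.mul (hd t ht)).congr_deriv (by ring)
  have hup : ∀ r, s ≤ r → 0 < f r := fun r hr => by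
    have h1 : Real.exp s * f s ≤ Real.exp r * f r := hmono hs (hs.trans hr) hr
    exact pos_of_mul_pos_right ((mul_pos (Real.exp_pos s) hfs).trans_le h1) (Real.exp_pos r).le
  -- A zero at `r > 0` would be an interior minimum, so `f' = 0` there, forcing `G r = 0`.
  -- Positivity thus passes from `α * r` back to `r`.
  have hdown : ∀ r, 0 < r → 0 < f (α * r) → 0 < f r := fun r hr hfr => by
    refine (hf r).lt_of_ne' fun h0 => ?_
    have hmin : IsLocalMin f r := Eventually.of_forall fun y => h0 ▸ hf y
    have := hmin.hasDerivAt_eq_zero ((hd r hr.le).hasDerivAt (Ici_mem_nhds hr))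
    linarith [hG' r hfr]
  obtain ⟨n, hn⟩ := pow_unbounded_of_one_lt (s / t) hα
  have key : ∀ n : ℕ, ∀ r, 0 < r → s ≤ α ^ n * r → 0 < f r := by
    intro n
    induction n with
    | zero => intro r _ h; exact hup r (by simpa using h)
    | succ n ih =>
      intro r hr h
      exact hdown r hr (ih _ (by positivity) (by rw [← mul_assoc, ← pow_succ]; exact h))
  exact key n t ht ((div_lt_iff₀ ht).1 hn).le

lemma IsSolution.pos {α a : ℝ} (hα : 1 < α) {u : ℝ → ℝ} (hu : IsSolution α a u)
    (h0 : ∀ t, 0 ≤ u t) {s : ℝ} (hs : 0 ≤ s) (hus : 0 < u s) {t : ℝ} (ht : 0 < t) : 0 < u t :=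
  pos_of_exists_pos hα h0 (G := fun t => u (α * t) ^ 2) (fun _ => sq_nonneg _)
    (fun _ h => pow_pos h 2) hu.hasDeriv hs hus ht

lemma IsSolution.lt_one {α a : ℝ} (hα : 1 < α) {u : ℝ → ℝ} (hu : IsSolution α a u)
    (h0 : ∀ t, 0 ≤ u t) (h1 : ∀ t, u t ≤ 1) {s : ℝ} (hs : 0 ≤ s) (hus : u s < 1)
    {t : ℝ} (ht : 0 < t) : u t < 1 := by
  have := pos_of_exists_pos hα (f := fun t => 1 - u t) (G := fun t => 1 - u (α * t) ^ 2)
    (fun t => by linarith [h1 t]) (fun t => by nlinarith [h0 (α * t), h1 (α * t)])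
    (fun t h => by nlinarith [h0 (α * t)])
    (fun t ht => ((hu.hasDeriv t ht).const_sub 1).congr_deriv (by ring))
    hs (sub_pos.2 hus) ht
  linarith

/-- A solution that starts below one and converges to one must first come close to zero:
Lebesgue measure is an eigenmeasure of the linearization at one, with growth factor `2 / α`. -/
lemma IsSolution.exists_lt {α a : ℝ} (hα : 1 < α) (ha : a < 1) {u : ℝ → ℝ}
    (hu : IsSolution α a u) (h1 : ∀ t, u t ≤ 1)
    (hlim : Tendsto u atTop (𝓝 1)) : ∃ t, 0 ≤ t ∧ 2 - α < 1 - u t := by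
  by_contra! hle
  let w : ℝ → ℝ := fun r => 1 - u (max r 0)
  have hw : Continuous w := by
    have : Continuous fun r : ℝ => u (max r 0) :=
      hu.continuousOn.comp_continuous (by fun_prop) fun r => le_max_right r 0
    exact continuous_const.sub this
  let W : ℝ → ℝ := fun t => ∫ r in (0 : ℝ)..t, w r
  have hW : ∀ t, HasDerivAt W (w t) t := fun t =>
    intervalIntegral.integral_hasDerivAt_right (hw.intervalIntegrable 0 t)
      (hw.stronglyMeasurableAtFilter _ _) hw.continuousAt
  -- With `w = 1 - u`, the derivative is `w(αt) (2 - α - w(αt))`, nonnegative exactly because `w` is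
  -- assumed never to exceed `2 - α`.
  have hmono : MonotoneOn (fun t => 1 - u t + (W t - W (α * t))) (Ici 0) := by
    refine monotoneOn_Ici_of_hasDerivWithinAt_nonneg
      (f' := fun t => (1 - u (α * t)) * (1 + u (α * t) - α)) (fun t ht => ?_) fun t ht => ?_
    · have hαt : 0 ≤ α * t := by positivity
      have h2 : HasDerivAt (fun t => W (α * t)) (w (α * t) * α) t := by
        have h3 : HasDerivAt (fun t : ℝ => α * t) α t := by
          simpa using (hasDerivAt_id t).const_mul α
        exact (hW (α * t)).comp t h3
      refine (((hu.hasDeriv t ht).const_sub 1).add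
        ((hW t).sub h2).hasDerivWithinAt).congr_deriv ?_
      simp only [w, max_eq_left ht, max_eq_left hαt]
      ring
    · exact mul_nonneg (by linarith [h1 (α * t)]) (by linarith [hle (α * t) (by positivity)])
  have hbound : ∀ t, 0 ≤ t → u t ≤ a := fun t ht => by
    have h2 := hmono (mem_Ici.2 le_rfl) (mem_Ici.2 ht) ht
    have h3 : W (α * t) - W t = ∫ r in t..(α * t), w r :=
      intervalIntegral.integral_interval_sub_left (hw.intervalIntegrable _ _)
        (hw.intervalIntegrable _ _)
    have h4 : 0 ≤ ∫ r in t..(α * t), w r :=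
      intervalIntegral.integral_nonneg (by nlinarith) fun r _ => by
        simp only [w]; linarith [h1 (max r 0)]
    simp only [mul_zero, sub_self, add_zero, hu.initial] at h2
    linarith
  have := le_of_tendsto hlim ((eventually_ge_atTop 0).mono hbound)
  linarith

/-! ### Path sums and crossings -/

section Paths

variable {α : ℝ} {x : Vertex → ℝ}

@[simp] lemma partialSum_zero (v : Vertex) : partialSum α x v 0 = 0 := by simp [partialSum]

lemma partialSum_one (v : Vertex) : partialSum α x v 1 = x [] := by simp [partialSum]

lemma partialSum_cons (i : Fin 2) (w : Vertex) (m : ℕ) :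
    partialSum α x (i :: w) (m + 1) = x [] + α⁻¹ * partialSum α (fun w => x (i :: w)) w m := by
  simp only [partialSum]
  rw [Finset.sum_range_succ', Finset.mul_sum, add_comm]
  simp [pow_succ']
  exact Finset.sum_congr rfl fun j _ => by ring

lemma measurable_partialSum (v : Vertex) (m : ℕ) :
    Measurable fun x : Vertex → ℝ => partialSum α x v m := by
  unfold partialSum
  fun_prop

lemma partialSum_mono (hα : 0 ≤ α) (hx : ∀ v, 0 ≤ x v) (v : Vertex) :
    Monotone (partialSum α x v) := by
  refine monotone_nat_of_le_succ fun m => ?_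
  unfold partialSum
  rw [Finset.sum_range_succ]
  exact le_add_of_nonneg_right (mul_nonneg (by positivity) (hx _))

lemma partialSum_take (v : Vertex) {n m : ℕ} (h : m ≤ n + 1) :
    partialSum α x (v.take n) m = partialSum α x v m := by
  refine Finset.sum_congr rfl fun j hj => ?_
  rw [List.take_take, min_eq_left]
  have := Finset.mem_range.1 hj
  omega

/-- Removing the root shifts time by its clock and dilates it by `α`, the source of the argument `α
t` in the equation. -/
lemma partialSum_cons_le (hα : 0 < α) {t : ℝ} (i : Fin 2) (w : Vertex) (m : ℕ) :
    partialSum α x (i :: w) (m + 1) ≤ t ↔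
      partialSum α (fun w => x (i :: w)) w m ≤ α * (t - x []) := by
  rw [partialSum_cons, ← le_sub_iff_add_le', inv_mul_le_iff₀ hα]

lemma lt_partialSum_cons (hα : 0 < α) {t : ℝ} (i : Fin 2) (w : Vertex) (m : ℕ) :
    t < partialSum α x (i :: w) (m + 1) ↔
      α * (t - x []) < partialSum α (fun w => x (i :: w)) w m := by
  rw [← not_le, partialSum_cons_le hα, not_le]

/-- The set of vertices whose lifetime contains `t`. -/
def crossing (α : ℝ) (x : Vertex → ℝ) (t : ℝ) : Set Vertex :=
  {v | partialSum α x v v.length ≤ t ∧ t < partialSum α x v (v.length + 1)}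

lemma crossing_of_lt (hα : 0 < α) (hx : ∀ v, 0 < x v) {t : ℝ} (ht : 0 ≤ t) (h : t < x []) :
    crossing α x t = {[]} := by
  ext v
  simp only [crossing, mem_ofPred_eq, mem_singleton_iff]
  constructor
  · rintro ⟨h1, -⟩
    by_contra hv
    have h2 : partialSum α x v 1 ≤ partialSum α x v v.length :=
      partialSum_mono hα.le (fun v => (hx v).le) v (List.length_pos_iff.2 hv)
    rw [partialSum_one] at h2
    linarith
  · rintro rfl
    simpa [partialSum_one] using ⟨ht, h⟩

lemma crossing_of_le (hα : 0 < α) {t : ℝ} (h : x [] ≤ t) :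
    crossing α x t = ⋃ i : Fin 2,
      List.cons i '' crossing α (fun w => x (i :: w)) (α * (t - x [])) := by
  ext v
  rcases v with _ | ⟨i, w⟩
  · simp [crossing, partialSum_one, h]
  · simp [crossing, partialSum_cons_le hα, lt_partialSum_cons hα]

lemma leaves_eq_crossing (hα : 0 < α) (hx : ∀ v, 0 < x v) (t : ℝ) :
    leaves α x t = crossing α x t := by
  unfold leaves
  split_ifs with h
  · rw [h, crossing_of_lt hα hx le_rfl (hx _)]
  · rfl

/-! ### Measurability and the generating function of the number of leaves. -/

lemma measurable_crossing :
    Measurable fun p : ℝ × (Vertex → ℝ) => crossing α p.2 p.1 := by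
  rw [measurable_set_iff]
  intro v
  refine measurableSet_setOfPred.1 (MeasurableSet.inter ?_ ?_)
  · exact measurableSet_le ((measurable_partialSum v _).comp measurable_snd) measurable_fst
  · exact measurableSet_lt measurable_fst ((measurable_partialSum v _).comp measurable_snd)

lemma measurableSet_crossing_finite :
    MeasurableSet {p : ℝ × (Vertex → ℝ) | (crossing α p.2 p.1).Finite} := by
  have : {p : ℝ × (Vertex → ℝ) | (crossing α p.2 p.1).Finite} =
      (fun p => (crossing α p.2 p.1).encard) ⁻¹' (Iio ⊤) := by
    ext p; simp [encard_lt_top_iff]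
  rw [this]
  exact (measurable_encard.comp measurable_crossing) (MeasurableSet.of_discrete)

open scoped Classical in
/-- `a ^ |V(t)|`, which is understood to be zero when `V(t)` is infinite. -/
noncomputable def leafPow (α a t : ℝ) (x : Vertex → ℝ) : ℝ :=
  if (crossing α x t).Finite then a ^ (crossing α x t).ncard else 0

open scoped Classical in
lemma leafPow_of_le {a : ℝ} (hα : 0 < α) {t : ℝ} (h : x [] ≤ t) :
    leafPow α a t x = ∏ i : Fin 2, leafPow α a (α * (t - x [])) (fun w => x (i :: w)) := by
  set C : Fin 2 → Set Vertex := fun i => crossing α (fun w => x (i :: w)) (α * (t - x []))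
  have hU : crossing α x t = List.cons 0 '' C 0 ∪ List.cons 1 '' C 1 := by
    rw [crossing_of_le hα h]
    ext v
    simp only [mem_iUnion, Fin.exists_fin_two, mem_union]
    rfl
  have hfin : ∀ i, (List.cons i '' C i).Finite ↔ (C i).Finite := fun i =>
    finite_image_iff List.cons_injective.injOn
  have hdisj : Disjoint (List.cons 0 '' C 0) (List.cons 1 '' C 1) := by
    rw [Set.disjoint_left]
    rintro _ ⟨w, _, rfl⟩ ⟨w', _, h⟩
    simp at h
  rw [Fin.prod_univ_two]
  change leafPow α a t x = (if (C 0).Finite then a ^ (C 0).ncard else 0) *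
    (if (C 1).Finite then a ^ (C 1).ncard else 0)
  unfold leafPow
  rw [hU, finite_union, hfin, hfin]
  by_cases h0 : (C 0).Finite <;> by_cases h1 : (C 1).Finite <;> simp [h0, h1]
  rw [ncard_union_eq hdisj (h0.image _) (h1.image _),
    ncard_image_of_injective _ List.cons_injective,
    ncard_image_of_injective _ List.cons_injective, pow_add]

/-- Since `0 ^ 0 = 1`, the case `a = 0` is the indicator of an empty `V(t)`; `a = 1` is that of a
finite one. -/
lemma isRenewal_leafPow (hα : 0 < α) {a : ℝ} (h0 : 0 ≤ a) (h1 : a ≤ 1) :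
    IsRenewal α a (leafPow α a) where
  measurable := Measurable.ite measurableSet_crossing_finite
    ((measurable_from_nat (f := fun n => a ^ n)).comp
      (measurable_ncard.comp measurable_crossing)) measurable_const
  nonneg t x := by
    unfold leafPow
    split_ifs <;> positivity
  le_one t x := by
    unfold leafPow
    split_ifs
    exacts [pow_le_one₀ h0 h1, zero_le_one]
  of_lt t x hx ht h := by simp [leafPow, crossing_of_lt hα hx ht h]
  of_le t x _ _ h := leafPow_of_le hα h

/-! ### The shortest path -/

/-- Every path is still alive at time `t` in generation `n`. -/
def allPathsGT (α : ℝ) (x : Vertex → ℝ) (t : ℝ) (n : ℕ) : Prop :=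
  ∀ v : Vertex, v.length = n → t < partialSum α x v (n + 1)

lemma allPathsGT_mono (hα : 0 < α) (hx : ∀ v, 0 ≤ x v) {t : ℝ} : Monotone (allPathsGT α x t) := by
  refine monotone_nat_of_le_succ fun n h v hv => ?_
  have h1 := h (v.take n) (by simp [hv])
  rw [partialSum_take v le_rfl] at h1
  exact h1.trans_le (partialSum_mono hα.le hx v (by omega))

lemma lt_iInf_partialSum_iff {t : ℝ} {n : ℕ} :
    (t : EReal) < ⨅ (v : Vertex) (_ : v.length = n), (partialSum α x v (n + 1) : EReal) ↔
      allPathsGT α x t n := by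
  constructor
  · intro h v hv
    exact EReal.coe_lt_coe_iff.1 (h.trans_le (iInf₂_le v hv))
  · intro h
    -- A generation is finite, so the infimum is attained and the strict inequality survives.
    obtain ⟨v, hv, hmin⟩ := Set.exists_min_image {v : Vertex | v.length = n}
      (fun v => partialSum α x v (n + 1)) (List.finite_length_eq _ n)
      ⟨List.replicate n 0, List.length_replicate⟩
    exact (EReal.coe_lt_coe_iff.2 (h v hv)).trans_le
      (le_iInf₂ fun w hw => EReal.coe_le_coe_iff.2 (hmin w hw))

lemma lt_shortestPath_iff (hα : 0 < α) (hx : ∀ v, 0 ≤ x v) {t : ℝ} :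
    (t : EReal) < shortestPath α x ↔ ∃ n, allPathsGT α x t n := by
  have hmono : Monotone fun n : ℕ =>
      ⨅ (v : Vertex) (_ : v.length = n), (partialSum α x v (n + 1) : EReal) := by
    refine monotone_nat_of_le_succ fun n => le_iInf₂ fun v hv => ?_
    refine (iInf₂_le (v.take n) (by simp [hv])).trans ?_
    rw [partialSum_take v le_rfl, EReal.coe_le_coe_iff]
    exact partialSum_mono hα.le hx v (by omega)
  rw [shortestPath, (tendsto_atTop_iSup hmono).liminf_eq, lt_iSup_iff]
  simp only [lt_iInf_partialSum_iff]

/-- A vertex beyond generation `n` is born only after its ancestor in generation `n` dies, hence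
after `t`. -/
lemma crossing_finite_of_allPathsGT (hα : 0 < α) (hx : ∀ v, 0 ≤ x v) {t : ℝ} {n : ℕ}
    (h : allPathsGT α x t n) : (crossing α x t).Finite := by
  refine (List.finite_length_le (Fin 2) n).subset fun v hv => ?_
  by_contra hlt
  have hlt : n < v.length := by simpa using hlt
  have h1 := h (v.take n) (by simp [hlt.le])
  rw [partialSum_take v le_rfl] at h1
  have h2 := partialSum_mono hα.le hx v hlt
  exact absurd (h1.trans_le (h2.trans hv.1)) (lt_irrefl _)

/-- By induction on the generation, every vertex is born by time `t` and, not being in `V(t)`, has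
also died by then. -/
lemma not_allPathsGT_of_crossing_eq_empty {t : ℝ} (ht : 0 ≤ t) (h : crossing α x t = ∅)
    (n : ℕ) : ¬ allPathsGT α x t n := by
  have key : ∀ n, ∀ v : Vertex, v.length = n → partialSum α x v (n + 1) ≤ t := by
    intro n
    induction n with
    | zero =>
      intro v hv
      by_contra! hlt
      have : v ∈ crossing α x t := ⟨by simpa [hv] using ht, by simpa [hv] using hlt⟩
      simp [h] at this
    | succ n ih =>
      intro v hv
      by_contra! hlt
      have h1 := ih (v.take n) (by simp [hv])
      rw [partialSum_take v le_rfl] at h1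
      have : v ∈ crossing α x t := ⟨by rwa [hv], by rwa [hv]⟩
      simp [h] at this
  intro hall
  exact absurd (hall (List.replicate n 0) List.length_replicate)
    (not_lt.2 (key n _ List.length_replicate))

lemma exists_allPathsGT_iff (hα : 0 < α) (hx : ∀ v, 0 ≤ x v) {t : ℝ} :
    (∃ n, allPathsGT α x t n) ↔
      ∀ i : Fin 2, ∃ n, allPathsGT α (fun w => x (i :: w)) (α * (t - x [])) n := by
  have hsucc : ∀ n, allPathsGT α x t (n + 1) ↔
      ∀ i : Fin 2, allPathsGT α (fun w => x (i :: w)) (α * (t - x [])) n := by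
    intro n
    constructor
    · intro h i w hw
      exact (lt_partialSum_cons hα i w (n + 1)).1 (h (i :: w) (by simp [hw]))
    · rintro h (_ | ⟨i, w⟩) hv
      · simp at hv
      · exact (lt_partialSum_cons hα i w (n + 1)).2 (h i w (by simpa using hv))
  constructor
  · rintro ⟨n, hn⟩ i
    exact ⟨n, (hsucc n).1 (allPathsGT_mono hα hx n.le_succ hn) i⟩
  · intro h
    choose m hm using h
    refine ⟨max (m 0) (m 1) + 1, (hsucc _).2 fun i => ?_⟩
    refine allPathsGT_mono hα (fun w => hx _) ?_ (hm i)
    fin_cases i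
    exacts [le_max_left _ _, le_max_right _ _]

open scoped Classical in
/-- The indicator function of the event that the shortest path exceeds `t`. -/
noncomputable def shortInd (α t : ℝ) (x : Vertex → ℝ) : ℝ :=
  if ∃ n, allPathsGT α x t n then 1 else 0

lemma isRenewal_shortInd (hα : 0 < α) : IsRenewal α 1 (shortInd α) where
  measurable := by
    refine Measurable.ite ?_ measurable_const measurable_const
    simp only [allPathsGT, ofPred_exists, ofPred_forall]
    exact MeasurableSet.iUnion fun n => MeasurableSet.iInter fun v => MeasurableSet.iInter fun _ =>
      measurableSet_lt measurable_fst ((measurable_partialSum v _).comp measurable_snd)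
  nonneg t x := by unfold shortInd; split_ifs <;> norm_num
  le_one t x := by unfold shortInd; split_ifs <;> norm_num
  of_lt t x _ _ h := by
    refine if_pos ⟨0, fun v _ => ?_⟩
    rwa [zero_add, partialSum_one]
  of_le t x hx _ _ := by
    unfold shortInd
    rw [exists_allPathsGT_iff hα (fun v => (hx v).le), Fin.prod_univ_two,
      Fin.forall_fin_two]
    split_ifs <;> simp_all

end Paths

/-! ### The longest path is finite -/

/-- Union bound: the threshold makes each tail at most `4⁻ⁿ`, which beats the `2ⁿ` vertices. -/
lemma clockLaw_exists_gt_le (n : ℕ) :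
    clockLaw {x | ∃ v : Vertex, v.length = n ∧ 2 * ((n : ℝ) + 1) < x v} ≤
      ENNReal.ofReal ((1 / 2) ^ n) := by
  have hset : {x : Vertex → ℝ | ∃ v : Vertex, v.length = n ∧ 2 * ((n : ℝ) + 1) < x v} =
      ⋃ v : List.Vector (Fin 2) n, (fun x => x v.1) ⁻¹' Ioi (2 * ((n : ℝ) + 1)) := by
    ext x
    simp only [mem_ofPred_eq, mem_iUnion, mem_preimage, mem_Ioi]
    exact ⟨fun ⟨v, hv, h⟩ => ⟨⟨v, hv⟩, h⟩, fun ⟨v, h⟩ => ⟨v.1, v.2, h⟩⟩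
  have hv : ∀ v : Vertex, clockLaw ((fun x => x v) ⁻¹' Ioi (2 * ((n : ℝ) + 1))) =
      ENNReal.ofReal (Real.exp (-(2 * ((n : ℝ) + 1)))) := fun v => by
    rw [← Measure.map_apply (measurable_pi_apply v) measurableSet_Ioi, map_eval_clockLaw,
      expMeasure_Ioi (by positivity)]
  rw [hset]
  refine (measure_iUnion_fintype_le _ _).trans ?_
  simp only [hv, Finset.sum_const, Finset.card_univ, card_vector, Fintype.card_fin, nsmul_eq_mul]
  rw [← ENNReal.ofReal_natCast, ← ENNReal.ofReal_mul (by positivity)]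
  refine ENNReal.ofReal_le_ofReal ?_
  have h2 : (4 : ℝ) ≤ Real.exp 2 := by
    have h := Real.exp_one_gt_d9
    have : Real.exp 2 = Real.exp 1 * Real.exp 1 := by rw [← Real.exp_add]; norm_num
    nlinarith
  have h3 : Real.exp (-(2 * ((n : ℝ) + 1))) ≤ (1 / 4) ^ n := by
    rw [Real.exp_neg, one_div, inv_pow]
    refine inv_anti₀ (by positivity) ?_
    calc (4 : ℝ) ^ n ≤ Real.exp 2 ^ n := pow_le_pow_left₀ (by norm_num) h2 n
      _ = Real.exp (2 * n) := by rw [← Real.exp_nat_mul, mul_comm]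
      _ ≤ _ := Real.exp_le_exp.2 (by linarith)
  calc ((2 ^ n : ℕ) : ℝ) * Real.exp (-(2 * ((n : ℝ) + 1))) ≤ 2 ^ n * (1 / 4) ^ n := by
        push_cast; gcongr
    _ = (1 / 2) ^ n := by rw [← mul_pow]; norm_num

/-- Borel–Cantelli handles all but finitely many generations; the constant `K` absorbs the remaining
finite set of clocks. -/
lemma ae_exists_clock_le :
    ∀ᵐ x ∂clockLaw, ∃ K : ℝ, ∀ v : Vertex, x v ≤ K * ((v.length : ℝ) + 1) := by
  have hsum : ∑' n : ℕ, clockLaw {x | ∃ v : Vertex, v.length = n ∧ 2 * ((n : ℝ) + 1) < x v} ≠ ⊤ := by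
    refine ne_top_of_le_ne_top ?_ (ENNReal.tsum_le_tsum clockLaw_exists_gt_le)
    exact summable_geometric_two.tsum_ofReal_ne_top
  filter_upwards [ae_eventually_notMem hsum] with x hx
  obtain ⟨N, hN⟩ := eventually_atTop.1 hx
  obtain ⟨C, hC⟩ := ((List.finite_length_lt (Fin 2) N).image x).bddAbove
  refine ⟨max C 2, fun v => ?_⟩
  have h1 : (0 : ℝ) ≤ v.length := Nat.cast_nonneg _
  have h2 : 2 ≤ max C 2 := le_max_right _ _
  rcases lt_or_ge v.length N with h | h
  · have : x v ≤ C := hC (mem_image_of_mem x h)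
    nlinarith [le_max_left C 2]
  · have := hN _ h
    simp only [not_exists, not_and, not_lt] at this
    nlinarith [this v rfl]

lemma ae_exists_partialSum_le {α : ℝ} (hα : 1 < α) :
    ∀ᵐ x ∂clockLaw, ∃ C : ℝ, ∀ v m, partialSum α x v m ≤ C := by
  filter_upwards [ae_exists_clock_le, ae_clock_pos] with x ⟨K, hK⟩ hx
  have hK0 : 0 ≤ K := by
    have := hK []
    simp only [List.length_nil, Nat.cast_zero, zero_add, mul_one] at this
    exact (hx []).le.trans this
  have hnorm : ‖α⁻¹‖ < 1 := by
    rw [Real.norm_of_nonneg (by positivity)]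
    exact inv_lt_one_of_one_lt₀ hα
  have hs : Summable fun j : ℕ => (α⁻¹) ^ j * (K * ((j : ℝ) + 1)) := by
    have h1 := summable_pow_mul_geometric_of_norm_lt_one 1 hnorm
    have h2 := summable_geometric_of_norm_lt_one hnorm
    refine ((h1.add h2).mul_left K).congr fun j => ?_
    ring
  refine ⟨∑' j : ℕ, (α⁻¹) ^ j * (K * ((j : ℝ) + 1)), fun v m => ?_⟩
  refine le_trans (Finset.sum_le_sum fun j _ => ?_)
    (hs.sum_le_tsum (Finset.range m) fun j _ => by positivity)
  refine mul_le_mul_of_nonneg_left ((hK _).trans ?_) (by positivity)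
  have : ((v.take j).length : ℝ) ≤ j := by exact_mod_cast List.length_take_le j v
  gcongr

/-- The probability that no vertex is alive at time `t` tends to one. -/
lemma tendsto_expect_leafPow_zero {α : ℝ} (hα : 1 < α) :
    Tendsto (expect (leafPow α 0)) atTop (𝓝 1) := by
  have hr := isRenewal_leafPow (α := α) (by linarith) le_rfl zero_le_one
  have h := tendsto_integral_filter_of_dominated_convergence (μ := clockLaw) (l := atTop)
    (F := leafPow α 0) (f := fun _ => 1) (fun _ => 1)
    (Eventually.of_forall fun t => (hr.measurable_apply t).aestronglyMeasurable)
    (Eventually.of_forall fun t => ae_of_all _ (hr.norm_le t)) (integrable_const _) ?_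
  · simp only [integral_const, probReal_univ, one_smul] at h
    exact h
  · filter_upwards [ae_exists_partialSum_le hα] with x ⟨C, hC⟩
    refine tendsto_const_nhds.congr' ?_
    filter_upwards [eventually_ge_atTop C] with t ht
    have : crossing α x t = ∅ := by
      refine eq_empty_of_forall_notMem fun v hv => ?_
      linarith [hv.2, hC v (v.length + 1)]
    simp [leafPow, this]

/-! ### Infinitely many crossings -/

lemma leafPow_mono {α a b t : ℝ} {x : Vertex → ℝ} (ha : 0 ≤ a) (hab : a ≤ b) :
    leafPow α a t x ≤ leafPow α b t x := by
  unfold leafPow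
  split_ifs
  exacts [pow_le_pow_left₀ ha hab _, le_rfl]

lemma expect_leafPow_mono {α a b : ℝ} (hα : 0 < α) (ha : 0 ≤ a) (hab : a ≤ b) (hb : b ≤ 1)
    (t : ℝ) : expect (leafPow α a) t ≤ expect (leafPow α b) t :=
  integral_mono ((isRenewal_leafPow hα ha (hab.trans hb)).integrable t)
    ((isRenewal_leafPow hα (ha.trans hab) hb).integrable t) fun _ => leafPow_mono ha hab

/-- Giving infinite `V(t)` the value zero makes the pointwise limit the indicator of finiteness, not
the constant one. -/
lemma tendsto_expect_leafPow {α : ℝ} (hα : 0 < α) {a : ℕ → ℝ} (h0 : ∀ n, 0 ≤ a n)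
    (h1 : ∀ n, a n ≤ 1) (hlim : Tendsto a atTop (𝓝 1)) (t : ℝ) :
    Tendsto (fun n => expect (leafPow α (a n)) t) atTop (𝓝 (expect (leafPow α 1) t)) := by
  refine tendsto_integral_of_dominated_convergence (fun _ => 1)
    (fun n => ((isRenewal_leafPow hα (h0 n) (h1 n)).measurable_apply t).aestronglyMeasurable)
    (integrable_const _)
    (fun n => ae_of_all _ ((isRenewal_leafPow hα (h0 n) (h1 n)).norm_le t))
    (ae_of_all _ fun x => ?_)
  unfold leafPow
  split_ifs
  exacts [hlim.pow _, tendsto_const_nhds]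

/-- With positive probability, infinitely many vertices are alive at some time. -/
lemma exists_expect_leafPow_one_lt {α : ℝ} (hα₁ : 1 < α) (hα₂ : α < 2) :
    ∃ t, 0 ≤ t ∧ expect (leafPow α 1) t < 1 := by
  have hα : 0 < α := by linarith
  obtain ⟨a, hmono, ha, hlim⟩ := exists_seq_strictMono_tendsto' (zero_lt_one (α := ℝ))
  have hr := fun n => isRenewal_leafPow hα (ha n).1.le (ha n).2.le
  have hsol := fun n => (hr n).isSolution hα.le
  have hle0 : ∀ n t, expect (leafPow α 0) t ≤ expect (leafPow α (a n)) t := fun n t =>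
    expect_leafPow_mono hα le_rfl (ha n).1.le (ha n).2.le t
  obtain ⟨M, hM⟩ := eventually_atTop.1
    ((tendsto_expect_leafPow_zero hα₁).eventually (lt_mem_nhds (show α - 1 < 1 by linarith)))
  -- Times in `[0, M]` where the `n`-th solution has dipped; the sets are nested because `u_a`
  -- increases with `a`.
  let K : ℕ → Set ℝ := fun n => Icc 0 M ∩ expect (leafPow α (a n)) ⁻¹' Iic (α - 1)
  have hclosed : ∀ n, IsClosed (K n) := fun n =>
    ((hsol n).continuousOn.mono Icc_subset_Ici_self).preimage_isClosed_of_isClosed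
      isClosed_Icc isClosed_Iic
  have hne : ∀ n, (K n).Nonempty := fun n => by
    have hone : Tendsto (expect (leafPow α (a n))) atTop (𝓝 1) :=
      tendsto_of_tendsto_of_tendsto_of_le_of_le (tendsto_expect_leafPow_zero hα₁)
        tendsto_const_nhds (hle0 n) (hr n).expect_le_one
    obtain ⟨t, ht, hlt⟩ := (hsol n).exists_lt hα₁ (ha n).2 (hr n).expect_le_one hone
    refine ⟨t, ⟨ht, ?_⟩, mem_preimage.2 (mem_Iic.2 (by linarith))⟩
    by_contra! h
    linarith [hM t h.le, hle0 n t]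
  have hanti : ∀ n, K (n + 1) ⊆ K n := fun n t ht =>
    ⟨ht.1, (expect_leafPow_mono hα (ha n).1.le (hmono n.lt_succ_self).le (ha _).2.le t).trans ht.2⟩
  obtain ⟨t, ht⟩ := IsCompact.nonempty_iInter_of_sequence_nonempty_isCompact_isClosed K hanti hne
    (isCompact_Icc.of_isClosed_subset (hclosed 0) inter_subset_left) hclosed
  rw [mem_iInter] at ht
  refine ⟨t, (ht 0).1.1, ?_⟩
  have := le_of_tendsto (tendsto_expect_leafPow hα (fun n => (ha n).1.le) (fun n => (ha n).2.le)
    hlim t) (Eventually.of_forall fun n => (ht n).2)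
  linarith

/-! ### Transfer to an arbitrary probability space -/

section Transfer

variable {Ω : Type*} [MeasurableSpace Ω] {P : Measure Ω} [IsProbabilityMeasure P]
  {T : Vertex → Ω → ℝ} {α : ℝ}

/-- Agreement is required only for positive clocks, where the deterministic tree lemmas hold; this
is an almost sure event. -/
lemma real_eq_clockLaw_real (hT : IsExpClocks P T) {A : Set Ω} {S : Set (Vertex → ℝ)}
    (hS : MeasurableSet S)
    (h : ∀ ω, (∀ v, 0 < T v ω) → (ω ∈ A ↔ (fun v => T v ω) ∈ S)) :
    P.real A = clockLaw.real S := by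
  have hm : Measurable fun ω v => T v ω := measurable_pi_iff.2 hT.measurable
  rw [← map_clocks hT, map_measureReal_apply hm hS]
  have hpos : ∀ᵐ ω ∂P, ∀ v, 0 < T v ω := by
    have := ae_clock_pos
    rw [← map_clocks hT] at this
    exact ae_of_ae_map hm.aemeasurable this
  refine measureReal_congr ?_
  filter_upwards [hpos] with ω hω
  exact propext (h ω hω)

lemma measurableSet_crossing_finite_apply (t : ℝ) :
    MeasurableSet {x : Vertex → ℝ | (crossing α x t).Finite} :=
  measurable_prodMk_left (x := t) measurableSet_crossing_finite

lemma real_finiteCrossing (hT : IsExpClocks P T) (hα : 0 < α) (t : ℝ) :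
    P.real (finiteCrossing α T t) = expect (leafPow α 1) t := by
  rw [real_eq_clockLaw_real hT (measurableSet_crossing_finite_apply (α := α) t) fun ω hω => by
      rw [finiteCrossing, mem_ofPred_eq, leaves_eq_crossing hα hω]; rfl,
    expect, ← integral_indicator_one (measurableSet_crossing_finite_apply t)]
  congr 1
  ext x
  by_cases h : (crossing α x t).Finite <;> simp [leafPow, h]

lemma measurableSet_exists_allPathsGT (t : ℝ) :
    MeasurableSet {x : Vertex → ℝ | ∃ n, allPathsGT α x t n} := by
  simp only [allPathsGT, ofPred_exists, ofPred_forall]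
  exact MeasurableSet.iUnion fun n => MeasurableSet.iInter fun v => MeasurableSet.iInter fun _ =>
    measurableSet_lt measurable_const (measurable_partialSum v _)

lemma real_shortestPathGT (hT : IsExpClocks P T) (hα : 0 < α) (t : ℝ) :
    P.real (shortestPathGT α T t) = expect (shortInd α) t := by
  rw [real_eq_clockLaw_real hT (measurableSet_exists_allPathsGT (α := α) t) fun ω hω => by
      rw [shortestPathGT, mem_ofPred_eq, lt_shortestPath_iff hα fun v => (hω v).le]; rfl,
    expect, ← integral_indicator_one (measurableSet_exists_allPathsGT t)]
  rfl

end Transfer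

/-- If no vertex is alive at time `t`, then `V(t)` is finite while `S ≤ t`. -/
lemma expect_shortInd_add_le {α : ℝ} (hα : 0 < α) {t : ℝ} (ht : 0 ≤ t) :
    expect (shortInd α) t + expect (leafPow α 0) t ≤ expect (leafPow α 1) t := by
  have h1 := (isRenewal_shortInd hα).integrable t
  have h2 := (isRenewal_leafPow hα le_rfl zero_le_one).integrable t
  have h3 := (isRenewal_leafPow hα zero_le_one le_rfl).integrable t
  rw [expect, expect, ← integral_add h1 h2]
  refine integral_mono_ae (h1.add h2) h3 ?_
  filter_upwards [ae_clock_pos] with x hx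
  by_cases hS : ∃ n, allPathsGT α x t n
  · have hne : crossing α x t ≠ ∅ := fun h =>
      not_allPathsGT_of_crossing_eq_empty ht h _ hS.choose_spec
    have hfin := crossing_finite_of_allPathsGT hα (fun v => (hx v).le) hS.choose_spec
    have hcard : (crossing α x t).ncard ≠ 0 := by rwa [ne_eq, ncard_eq_zero hfin]
    simp [shortInd, leafPow, hS, hfin, hcard]
  · simpa [shortInd, hS] using leafPow_mono le_rfl zero_le_one

end AlphaRiccati

theorem mainTheorem3 {Ω : Type*} [MeasurableSpace Ω] (P : Measure Ω) [IsProbabilityMeasure P]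
    (α : ℝ) (hα₁ : 1 < α) (hα₂ : α < 2)
    (T : AlphaRiccati.Vertex → Ω → ℝ) (hT : AlphaRiccati.IsExpClocks P T) :
    let v : ℝ → ℝ := fun t => P.real (AlphaRiccati.finiteCrossing α T t)
    let uLow : ℝ → ℝ := fun t => P.real (AlphaRiccati.shortestPathGT α T t)
    let uHigh : ℝ → ℝ := fun _ => 1
    AlphaRiccati.IsSolution α 1 v ∧
    AlphaRiccati.IsSolution α 1 uLow ∧
    AlphaRiccati.IsSolution α 1 uHigh ∧
    (∀ t : ℝ, 0 < t → uLow t < v t ∧ v t < uHigh t) ∧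
    ¬ Set.EqOn v uLow (Set.Ici 0) ∧
    ¬ Set.EqOn v uHigh (Set.Ici 0) := by
  open AlphaRiccati in
  intro v uLow uHigh
  have hα : 0 < α := by linarith
  have hv : v = expect (leafPow α 1) := funext (real_finiteCrossing hT hα)
  have hLow : uLow = expect (shortInd α) := funext (real_shortestPathGT hT hα)
  have hr₀ := isRenewal_leafPow hα le_rfl zero_le_one
  have hr₁ := isRenewal_leafPow hα zero_le_one le_rfl
  have hstrict : ∀ t : ℝ, 0 < t → uLow t < v t ∧ v t < uHigh t := by
    intro t ht
    constructor
    · obtain ⟨s, hs⟩ := eventually_atTop.1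
        ((tendsto_expect_leafPow_zero hα₁).eventually (lt_mem_nhds zero_lt_one))
      have hpos : 0 < expect (leafPow α 0) t :=
        (hr₀.isSolution hα.le).pos hα₁ hr₀.expect_nonneg (le_max_right s 0)
          (hs _ (le_max_left s 0)) ht
      rw [hv, hLow]
      linarith [expect_shortInd_add_le hα ht.le]
    · obtain ⟨s, hs, hlt⟩ := exists_expect_leafPow_one_lt hα₁ hα₂
      rw [hv]
      exact (hr₁.isSolution hα.le).lt_one hα₁ hr₁.expect_nonneg hr₁.expect_le_one hs hlt ht
  refine ⟨hv ▸ hr₁.isSolution hα.le, hLow ▸ (isRenewal_shortInd hα).isSolution hα.le,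
    ⟨rfl, fun t _ => ?_⟩, hstrict, fun h => ?_, fun h => ?_⟩
  · simpa [uHigh] using hasDerivWithinAt_const t (Set.Ici 0) (1 : ℝ)
  · exact (hstrict 1 one_pos).1.ne' (h (Set.mem_Ici.2 zero_le_one))
  · exact (hstrict 1 one_pos).2.ne (h (Set.mem_Ici.2 zero_le_one))
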